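/- Let $p$ be a prime, $q=p^a$ with $a\ge 1$, $\mathbb{Z}_q=W(\mathbb{F}_q)$, $\mathbb{Q}_q=\mathbb{Z}_q[1/p]$, and let $\sigma$ be the Frobenius automorphism of $\mathbb{Q}_q/\mathbb{Q}_p$. Let $d\ge 2$, $\lambda\in\mathbb{F}_q^\times$ with Teichmüller lift $\hat\lambda\in\mathbb{Z}_q$, and $0\le u\le q-1$ with base $p$ expansion $u=u_0+u_1p+\dots+u_{a-1}p^{a-1}$, $0\le u_i\le p-1$. Let $b$ be the least positive integer with $p^bu\equiv u \pmod{q-1}$. For $0\le i<b$ let $s_i\in[0,q-2]$ be the residue of $p^iu$ modulo $q-1$ if $u<q-1$, and let $s_i=q-1$ if $u=q-1$. Let $E(X)=\exp\big(\sum_{i\ge0}X^{p^i}/p^i\big)$ be the Artin-Hasse series, let $\pi$ be the uniformizer of $\mathbb{Q}_p[[T]]$ with $E(\pi)=1+T$, and put $\varpi=\pi^{1/(d(q-1))}$ and $E_f(x)=E(\pi x^d)E(\pi\hat\lambda x)$. On formal series $\sum_{v\ge0} b_v x^{v/(q-1)}$ with coefficients $b_v\in\mathbb{Q}_q[[\varpi]]$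 let $\psi_p\big(\sum_v b_vx^{v/(q-1)}\big)=\sum_v b_{pv}x^{v/(q-1)}$, let $\sigma^{-1}$ act on the coefficients of the series in $\varpi$ and $x$ (fixing $\varpi$ and $x$), and let $\Psi=\sigma^{-1}\circ\psi_p\circ E_f(x)$ be Dwork's operator. Let $\xi_1,\dots,\xi_a$ be a basis of $\mathbb{Q}_q$ over $\mathbb{Q}_p$, and let $\Gamma$ be the infinite matrix over $\mathbb{Q}_p[[\varpi]]$ of $\Psi$ with respect to the elements $\xi_v x^{s_i/(q-1)+j}$ ($0\le i<b$, $1\le v\le a$, $j\ge 0$): its entry in row $(k,w,l)$ and column $(i,v,j)$ is the coefficient of $\xi_w x^{s_k/(q-1)+l}$ in $\Psi\big(\xi_v x^{s_i/(q-1)+j}\big)$. Let $C_N$ be the sum of all principal $N\times N$ minors of $\Gamma$, so that $\det(1-\Gamma s)=\sum_{N\ge 0}(-1)^NC_Ns^N$. Finally, for integers $n\ge0$ let $P_{\{1,d\},u}(n)=\sum_{l=0}^{n-1}\omega(l)$, where, with $\{\cdot\}$ the fractional part, $$\omega(l)=\frac{(p-1)l+\frac1b\sum_{i=0}^{b-1}u_i}{d}+(d-1)\,\frac1b\sum_{i=0}^{b-1}\left(\left\{\frac{pl+u_i}{d}\right\}-\left\{\frac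 ld\right\}\right).$$ Theorem. If $1\le n\le d-1$ and $p>2(d-1)^2+1$, then the sum defining $C_{abn}$ converges $\varpi$-adically (for every $m$, only finitely many principal $abn\times abn$ minors of $\Gamma$ have a nonzero coefficient of $\varpi^m$), and the $\pi$-adic order of $C_{abn}$ (normalized by $\operatorname{ord}_\pi\pi=1$) is exactly $$\operatorname{ord}_\pi(C_{abn})=ab\,P_{\{1,d\},u}(n).$$ -/

import Mathlib

noncomputable section

namespace TwistedDwork

/-! ### The field `ℚ_q = W(𝔽_q)[1/p]` -/

/-- `ℚ_q`, the fraction field of the ring `ℤ_q = W(k)` of Witt vectors of `k = 𝔽_q`. -/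
abbrev Qq (p : ℕ) [Fact p.Prime] (k : Type*) [Field k] [CharP k p] : Type _ :=
  FractionRing (WittVector p k)

/-- The ring homomorphism `ℤ_p = W(𝔽_p) → W(k) = ℤ_q` induced by `𝔽_p → k`. -/
def padicIntToWitt (p : ℕ) [Fact p.Prime] (k : Type*) [Field k] [CharP k p] :
    ℤ_[p] →+* WittVector p k :=
  (WittVector.map (ZMod.castHom (dvd_refl p) k)).comp (WittVector.equiv p).symm.toRingHom

theorem padicIntToWitt_injective (p : ℕ) [Fact p.Prime] (k : Type*) [Field k] [CharP k p] :
    Function.Injective (padicIntToWitt p k) :=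
  (WittVector.map_injective _ (ZMod.castHom (dvd_refl p) k).injective).comp
    (WittVector.equiv p).symm.injective

/-- `ℚ_q` as an extension of `ℚ_p`. -/
instance algebraPadicQq (p : ℕ) [Fact p.Prime] (k : Type*) [Field k] [CharP k p] :
    Algebra ℚ_[p] (Qq p k) :=
  (IsFractionRing.map (K := ℚ_[p]) (L := Qq p k) (padicIntToWitt_injective p k)).toAlgebra

/-- The Teichmüller lift of `c ∈ k` in `ℚ_q`. -/
def teich (p : ℕ) [Fact p.Prime] (k : Type*) [Field k] [CharP k p] (c : k) : Qq p k :=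
  algebraMap (WittVector p k) (Qq p k) (WittVector.teichmuller p c)

/-! ### The Artin-Hasse series -/

/-- The series `∑_{i ≥ 0} X^{p^i} / p^i` over `ℚ`. -/
def artinHasseLog (p : ℕ) : PowerSeries ℚ :=
  open Classical in
  PowerSeries.mk fun n => if ∃ i : ℕ, n = p ^ i then (1 : ℚ) / n else 0

/-- The Artin-Hasse series `E(X) = exp (∑_{i ≥ 0} X^{p^i} / p^i) = ∑ λ_n X^n`. -/
def artinHasse (p : ℕ) : PowerSeries ℚ :=
  (PowerSeries.exp ℚ).subst (artinHasseLog p)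

/-! ### The coefficient ring

`ϖ` denotes the root `π^{1/(d(q-1))}` of the uniformizer `π` (where `E(π) = 1 + T`). It is the
variable of the power series rings `ℚ_q[[ϖ]]` and `ℚ_p[[ϖ]]`, and `π = ϖ^{d(q-1)}`. -/

/-- The ring `ℚ_q[[ϖ]]`, which contains `ℤ_q[[ϖ]]`. -/
abbrev Coef (p : ℕ) [Fact p.Prime] (k : Type*) [Field k] [CharP k p] : Type _ :=
  PowerSeries (Qq p k)

/-- The uniformizer `π = ϖ^{d(q-1)}`. -/
def unif (R : Type*) [CommRing R] (d q : ℕ) : PowerSeries R :=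
  PowerSeries.X ^ (d * (q - 1))

/-- The `π`-adic order of a power series in `ϖ`, so that `ϖ` has order `1/(d(q-1))` and `0` has
order `⊤`. -/
def ordPi {R : Type*} [CommRing R] (d q : ℕ) (F : PowerSeries R) : WithTop ℚ :=
  WithTop.map (fun m : ℕ => (m : ℚ) / ((d : ℚ) * ((q : ℚ) - 1))) F.order

/-- The image of the Artin-Hasse series in `ℚ_q[[ϖ]][[x]]`. -/
def artinHasseCoef (p : ℕ) [Fact p.Prime] (k : Type*) [Field k] [CharP k p] :
    PowerSeries (Coef p k) :=
  (artinHasse p).map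
    ((PowerSeries.C (R := Qq p k)).comp
      ((algebraMap ℚ_[p] (Qq p k)).comp (Rat.castHom ℚ_[p])))

/-- `E_f(x) = E(π x^d) E(π c x)`, with `c` the Teichmüller lift of `lam`, for the binomial
`f = x^d + lam x`. Its `n`-th coefficient is `γ_n`. -/
def splittingSeries (p : ℕ) [Fact p.Prime] (k : Type*) [Field k] [CharP k p] (d q : ℕ)
    (lam : k) : PowerSeries (Coef p k) :=
  PowerSeries.subst (PowerSeries.X ^ d : PowerSeries (Coef p k))
      (PowerSeries.rescale (unif (Qq p k) d q) (artinHasseCoef p k)) *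
    PowerSeries.rescale (unif (Qq p k) d q * PowerSeries.C (teich p k lam)) (artinHasseCoef p k)

/-! ### Dwork's semi-linear operator

A formal series `∑_v b_v x^{v/(q-1)}` with `b_v ∈ ℚ_q[[ϖ]]` is a power series in
`y = x^{1/(q-1)}`. This space contains the space `B` of the theory, on which the operator
below acts. -/

/-- The series `E_f(x)` as a power series in `y = x^{1/(q-1)}`. -/
def splittingSeriesRoot (p : ℕ) [Fact p.Prime] (k : Type*) [Field k] [CharP k p] (d q : ℕ)
    (lam : k) : PowerSeries (Coef p k) :=
  PowerSeries.subst (PowerSeries.X ^ (q - 1) : PowerSeries (Coef p k))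
    (splittingSeries p k d q lam)

/-- `ψ_p (∑ b_v x^{v/(q-1)}) = ∑ b_{pv} x^{v/(q-1)}`. -/
def psi {R : Type*} [CommRing R] (p : ℕ) (g : PowerSeries R) : PowerSeries R :=
  PowerSeries.mk fun v => PowerSeries.coeff (p * v) g

/-- `σ⁻¹`, the inverse of the Frobenius automorphism of `ℚ_q`, acting on the coefficients and
fixing `ϖ` and `x`. -/
def sigmaInv (p : ℕ) [Fact p.Prime] (k : Type*) [Field k] [CharP k p] [PerfectRing k p] :
    PowerSeries (Coef p k) →+* PowerSeries (Coef p k) :=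
  PowerSeries.map (PowerSeries.map
    ((WittVector.FractionRing.frobenius p k).symm : Qq p k →+* Qq p k))

/-- Dwork's operator `Ψ = σ⁻¹ ∘ ψ_p ∘ E_f(x)`. -/
def dworkOp (p : ℕ) [Fact p.Prime] (k : Type*) [Field k] [CharP k p] [PerfectRing k p]
    (d q : ℕ) (lam : k) (g : PowerSeries (Coef p k)) : PowerSeries (Coef p k) :=
  sigmaInv p k (psi p (splittingSeriesRoot p k d q lam * g))

/-! ### The twist and the basis of monomials -/

/-- The least positive integer `b` with `p^b u ≡ u (mod q-1)`. -/
def twistPeriod (p q u : ℕ) : ℕ :=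
  sInf {m : ℕ | 0 < m ∧ p ^ m * u ≡ u [MOD (q - 1)]}

/-- The `i`-th digit `u_i` of `u` in base `p`. -/
def digit (p u i : ℕ) : ℕ := u / p ^ i % p

/-- For `u < q - 1`, the residue `s_i` of `p^i u` modulo `q - 1`. For `u = q - 1`, all of whose
digits are `p - 1`, the residue class of `0` is represented by `s_i = q - 1`. In both cases `s_i`
is obtained from `u` by a cyclic permutation of its base `p` digits. -/
def residue (p q u i : ℕ) : ℕ :=
  if u = q - 1 then q - 1 else p ^ i * u % (q - 1)

/-- The index set of the basis `ξ_v x^{s_i/(q-1) + j}`, consisting of the triples `(i, v, j)` with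
`i` modulo `b`, `1 ≤ v ≤ a` and `j ∈ ℕ`. -/
abbrev Idx (p a u : ℕ) : Type := Fin (twistPeriod p (p ^ a) u) × Fin a × ℕ

/-- The exponent of `y = x^{1/(q-1)}` in `x^{s_i/(q-1) + j}`. -/
def expo (p a u : ℕ) (I : Idx p a u) : ℕ :=
  residue p (p ^ a) u (I.1 : ℕ) + (p ^ a - 1) * I.2.2

/-- The basis element `ξ_v x^{s_i/(q-1) + j}`. -/
def basisElt (p : ℕ) [Fact p.Prime] (k : Type*) [Field k] [CharP k p] (a u : ℕ)
    (ξ : Module.Basis (Fin a) ℚ_[p] (Qq p k)) (I : Idx p a u) : PowerSeries (Coef p k) :=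
  PowerSeries.monomial (expo p a u I) (PowerSeries.C (ξ I.2.1))

/-- The coordinate `F_w ∈ ℚ_p[[ϖ]]` in the expansion `F = ∑_w F_w ξ_w` of `F ∈ ℚ_q[[ϖ]]`. -/
def coordSeries {p : ℕ} [Fact p.Prime] {k : Type*} [Field k] [CharP k p] {a : ℕ}
    (ξ : Module.Basis (Fin a) ℚ_[p] (Qq p k)) (w : Fin a) (F : Coef p k) : PowerSeries ℚ_[p] :=
  PowerSeries.mk fun m => ξ.repr (PowerSeries.coeff m F) w

/-- The matrix `Γ` of `Ψ` with respect to the basis `ξ_v x^{s_i/(q-1) + j}` over `ℚ_p[[ϖ]]`. The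
column `J` lists the coordinates of the image of the `J`-th basis element. -/
def dworkMatrix (p : ℕ) [Fact p.Prime] (k : Type*) [Field k] [CharP k p] [PerfectRing k p]
    (a d u : ℕ) (lam : k) (ξ : Module.Basis (Fin a) ℚ_[p] (Qq p k)) :
    Matrix (Idx p a u) (Idx p a u) (PowerSeries ℚ_[p]) :=
  Matrix.of fun I J =>
    coordSeries ξ I.2.1
      (PowerSeries.coeff (expo p a u I) (dworkOp p k d (p ^ a) lam (basisElt p k a u ξ J)))

/-! ### The coefficients of the Fredholm determinant -/

/-- The principal minor of `G` on the finite set `S` of indices. -/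
def principalMinor {ι R : Type*} [DecidableEq ι] [CommRing R] (G : Matrix ι ι R)
    (S : Finset ι) : R :=
  (G.submatrix (Subtype.val : S → ι) (Subtype.val : S → ι)).det

/-- The sum of the principal `N × N` minors of `G` converges formally, i.e. for every `m` only
finitely many of them have a nonzero coefficient in degree `m`. -/
def MinorsSummable {ι R : Type*} [DecidableEq ι] [CommRing R]
    (G : Matrix ι ι (PowerSeries R)) (N : ℕ) : Prop :=
  ∀ m : ℕ, {S : Finset ι | S.card = N ∧ PowerSeries.coeff m (principalMinor G S) ≠ 0}.Finite

/-- `C_N`, the sum of all principal `N × N` minors of the infinite matrix `G` (in the `ϖ`-adic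
topology), so that `det (1 - G s) = ∑_N (-1)^N C_N s^N`. -/
def fredholmCoeff {ι R : Type*} [DecidableEq ι] [CommRing R]
    (G : Matrix ι ι (PowerSeries R)) (N : ℕ) : PowerSeries R :=
  PowerSeries.mk fun m =>
    ∑ᶠ S : {S : Finset ι // S.card = N}, PowerSeries.coeff m (principalMinor G S.1)

/-! ### The arithmetic polygon -/

/-- The slope `ω(l)` of the arithmetic polygon between the abscissas `l` and `l + 1`. -/
def arithSlope (p q d u l : ℕ) : ℚ :=
  (((p : ℚ) - 1) * l
      + (1 / (twistPeriod p q u : ℚ)) * ∑ i ∈ Finset.range (twistPeriod p q u), (digit p u i : ℚ))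
      / d
    + ((d : ℚ) - 1) * ((1 / (twistPeriod p q u : ℚ)) *
        ∑ i ∈ Finset.range (twistPeriod p q u),
          (Int.fract (((p : ℚ) * l + digit p u i) / d) - Int.fract ((l : ℚ) / d)))

/-- The arithmetic polygon `P_{{1,d},u}` at the integer `n`, which starts at `0` and has the slopes
`ω(0), ω(1), …`. -/
def arithPolygon (p q d u n : ℕ) : ℚ :=
  ∑ l ∈ Finset.range n, arithSlope p q d u l

end TwistedDwork

end

/-! Write D = d(q-1), so that π = ϖ^D, and let δ(m) be the least i+j with di+j = m (`minDegree`).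
The m-th coefficient γ_m of E_f is divisible by π^{δ(m)}. Since p·s_k = s_{k+1} + (q-1)t_k, where
t_k is a base p digit of u, the row (k,w,l) of Γ meets only columns of block k+1 mod b, where its
entries are coordinates of σ⁻¹(γ_{pl+t_k-j} ξ_v) (`coeff_dworkMatrix`).

Subadditivity of δ gives δ(pl+t_k-j) ≥ δ(pl+t_k) - δ(j). Rows and columns can therefore be rescaled
by powers of ϖ, and the minor on S is ϖ^{ΣDω(I)} times the minor of a reduced matrix, with ω(I) =
δ(pl+t_k) - δ(l) (`principalMinor_of_weights`). For p > 2(d-1)²+1 this slope is strictly increasing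
in l (`digitSlope_strictMono`).

The block cyclic shape forces a set with nonzero minor to meet all blocks in equally many indices,
here an. Among such sets, {l < n} alone has the least total slope, so C_{abn} has that order as soon
as the constant term of its reduced minor is nonzero. A kernel vector there would give, over ℚ_q, a
solution of n×n systems with entries 1/(r_l-j)! up to scaling, where r_l = (pl+t_k) mod d; the r_l
are distinct, so these are Vandermonde systems (`det_inv_factorial_ne_zero`).

Finally dδ(m) = m + (d-1)(m mod d) turns the slopes into the fractional parts of the arithmetic
polygon; the t_k run over the digits of u in a period, which produces the averages 1/b. -/

noncomputable section

namespace TwistedDwork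

/-! ### The least number of terms `1`, `d` summing to `m` -/

/-- The least `i + j` with `d * i + j = m`, which is the `π`-adic order of the `m`-th coefficient
of the splitting series. -/
def minDegree (d m : ℕ) : ℕ := m / d + m % d

theorem minDegree_of_lt {d m : ℕ} (h : m < d) : minDegree d m = m := by
  simp [minDegree, Nat.div_eq_of_lt h, Nat.mod_eq_of_lt h]

theorem mul_minDegree (d m : ℕ) (hd : 0 < d) : d * minDegree d m = m + (d - 1) * (m % d) := by
  obtain ⟨e, rfl⟩ : ∃ e, d = e + 1 := ⟨d - 1, by omega⟩
  have := Nat.div_add_mod m (e + 1)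
  simp only [minDegree, Nat.add_sub_cancel]
  nlinarith

theorem minDegree_le (d i j : ℕ) (hd : 0 < d) : minDegree d (d * i + j) ≤ i + j := by
  have h : (d * i + j) / d = i + j / d := by
    rw [Nat.mul_add_div hd]
  have h2 := Nat.div_add_mod j d
  have h3 : j / d ≤ d * (j / d) := Nat.le_mul_of_pos_left _ hd
  rw [minDegree, h, Nat.mul_add_mod]
  omega

/-- Trading d ones for one d saves d-1 > 0 terms, so the minimal representation is unique. This
makes the leading term of γ_m a single product. -/
theorem eq_of_add_le_minDegree {d i j : ℕ} (hd : 1 < d) (h : i + j ≤ minDegree d (d * i + j)) :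
    i = (d * i + j) / d ∧ j = (d * i + j) % d := by
  have h1 : (d * i + j) / d = i + j / d := by
    rw [Nat.mul_add_div (by omega)]
  have h2 := Nat.div_add_mod j d
  rw [minDegree, h1, Nat.mul_add_mod] at h
  have h3 : j / d = 0 := by
    by_contra h0
    have : 2 * (j / d) ≤ d * (j / d) := Nat.mul_le_mul_right _ hd
    omega
  rw [h1, Nat.mul_add_mod]
  rw [h3] at h2 ⊢
  omega

theorem minDegree_add_le (d m m' : ℕ) (hd : 0 < d) :
    minDegree d (m + m') ≤ minDegree d m + minDegree d m' := by
  have h := minDegree_le d (m / d + m' / d) (m % d + m' % d) hd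
  have h1 := Nat.div_add_mod m d
  have h2 := Nat.div_add_mod m' d
  have h3 : d * (m / d + m' / d) + (m % d + m' % d) = m + m' := by
    rw [mul_add]; omega
  rw [h3] at h
  unfold minDegree at *
  omega

theorem div_mod_sub_of_le {d m j : ℕ} (h : j ≤ m % d) (hd : 0 < d) :
    (m - j) / d = m / d ∧ (m - j) % d = m % d - j := by
  have h1 := Nat.div_add_mod m d
  have h2 := Nat.mod_lt m hd
  have h3 : m - j = d * (m / d) + (m % d - j) := by omega
  have h4 : m % d - j < d := by omega
  constructor
  · rw [h3, Nat.mul_add_div hd, Nat.div_eq_of_lt h4, Nat.add_zero]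
  · rw [h3, Nat.mul_add_mod, Nat.mod_eq_of_lt h4]

/-- Subtracting j borrows from the quotient, so the representation of m through m-j has d or more
ones and is not minimal. -/
theorem minDegree_lt_of_lt {d m j : ℕ} (h : m % d < j) (hd : 1 < d) (hjm : j ≤ m) :
    minDegree d m < minDegree d (m - j) + j := by
  by_contra! hcon
  have h1 := Nat.div_add_mod (m - j) d
  have e : d * ((m - j) / d) + ((m - j) % d + j) = m := by omega
  have h2 := eq_of_add_le_minDegree (d := d) (i := (m - j) / d) (j := (m - j) % d + j) hd (by
    rw [e]; unfold minDegree at *; omega)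
  rw [e] at h2
  omega

/-- This is where the bound on p enters. By `mul_minDegree`, d(δ(m+p) - δ(m)) ≥ p - (d-1)² > (d-1)²
+ 1 ≥ d, so δ gains more than 1 over a step of p, whereas it gains at most 1 over a unit step. -/
theorem minDegree_growth {p d m l : ℕ} (hd : 1 < d) (hp : 2 * (d - 1) ^ 2 + 1 < p) :
    minDegree d m + minDegree d (l + 1) < minDegree d (m + p) + minDegree d l := by
  have h1 := mul_minDegree d m (by omega)
  have h2 := mul_minDegree d (m + p) (by omega)
  have h3 : minDegree d (l + 1) ≤ minDegree d l + 1 := by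
    simpa [minDegree_of_lt hd] using minDegree_add_le d l 1 (by omega)
  obtain ⟨e, rfl⟩ : ∃ e, d = e + 1 := ⟨d - 1, by omega⟩
  have h4 : m % (e + 1) ≤ e := Nat.lt_succ_iff.mp (Nat.mod_lt _ (by omega))
  simp only [Nat.add_sub_cancel] at *
  suffices minDegree (e + 1) m + 1 < minDegree (e + 1) (m + p) by omega
  by_contra! hcon
  have h5 : e * (m % (e + 1)) ≤ e * e := Nat.mul_le_mul_left _ h4
  have h6 : (e + 1) * minDegree (e + 1) (m + p) ≤ (e + 1) * (minDegree (e + 1) m + 1) :=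
    Nat.mul_le_mul_left _ hcon
  have h7 : e ≤ e * e := Nat.le_mul_of_pos_left _ (by omega)
  nlinarith [Nat.zero_le (e * ((m + p) % (e + 1)))]

/-! ### The weight `ω_t(l)` of a row with twist digit `t` -/

/-- The slope contributed by the digit `t`. -/
def digitSlope (p d t l : ℕ) : ℕ := minDegree d (p * l + t) - minDegree d l

/-- Needed so that the truncated subtraction in `digitSlope` is a true difference. -/
theorem minDegree_le_mul_add {p d : ℕ} (t l : ℕ) (hd : 1 < d) (hp : 2 * (d - 1) ^ 2 + 1 < p) :
    minDegree d l ≤ minDegree d (p * l + t) := by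
  induction l with
  | zero => simp [minDegree]
  | succ l ih =>
    have := minDegree_growth (m := p * l + t) (l := l) hd hp
    rw [mul_add, mul_one, add_right_comm]
    omega

theorem minDegree_add_digitSlope {p d : ℕ} (t l : ℕ) (hd : 1 < d)
    (hp : 2 * (d - 1) ^ 2 + 1 < p) :
    minDegree d l + digitSlope p d t l = minDegree d (p * l + t) := by
  have := minDegree_le_mul_add t l hd hp
  unfold digitSlope
  omega

theorem digitSlope_strictMono {p d : ℕ} (t : ℕ) (hd : 1 < d) (hp : 2 * (d - 1) ^ 2 + 1 < p) :
    StrictMono (digitSlope p d t) := by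
  refine strictMono_nat_of_lt_succ fun l => ?_
  have h1 := minDegree_add_digitSlope t l hd hp
  have h2 := minDegree_add_digitSlope t (l + 1) hd hp
  have h3 := minDegree_growth (m := p * l + t) (l := l) hd hp
  rw [mul_add, mul_one, add_right_comm] at h2
  omega

theorem digitSlope_eq {p d : ℕ} (t l : ℕ) (hd : 1 < d) (hp : 2 * (d - 1) ^ 2 + 1 < p) :
    (digitSlope p d t l : ℚ) = (((p : ℚ) - 1) * l + t) / d + ((d : ℚ) - 1) *
      (Int.fract (((p : ℚ) * l + t) / d) - Int.fract ((l : ℚ) / d)) := by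
  have h1 := mul_minDegree d l (by omega)
  have h2 := mul_minDegree d (p * l + t) (by omega)
  rw [← minDegree_add_digitSlope t l hd hp] at h2
  have e1 : Int.fract ((l : ℚ) / d) = ((l % d : ℕ) : ℚ) / d :=
    Int.fract_div_natCast_eq_div_natCast_mod
  have e2 : Int.fract (((p : ℚ) * l + t) / d) = (((p * l + t) % d : ℕ) : ℚ) / d := by
    have := Int.fract_div_natCast_eq_div_natCast_mod (k := ℚ) (m := p * l + t) (n := d)
    push_cast at this ⊢
    exact this
  have hd0 : (d : ℚ) ≠ 0 := by positivity
  rw [e1, e2]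
  have h1' := congrArg (Nat.cast : ℕ → ℚ) h1
  have h2' := congrArg (Nat.cast : ℕ → ℚ) h2
  generalize (p * l + t) % d = r at *
  generalize l % d = r' at *
  push_cast [Nat.cast_sub hd.le] at h1' h2'
  field_simp
  linarith

/-! ### Residues and digits of the twist -/

/-- Multiplication by p^k modulo p^a - 1 rotates the base p digits: the top k digits of u become the
lowest. The convention for u = q-1 makes the formula hold there too. -/
theorem residue_formula {p a u k : ℕ} (hp : 1 < p) (hk : k ≤ a) (hu : u ≤ p ^ a - 1) :
    residue p (p ^ a) u k = p ^ k * (u % p ^ (a - k)) + u / p ^ (a - k) := by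
  have hq : p ^ k * p ^ (a - k) = p ^ a := by rw [← pow_add]; congr 1; omega
  have hpos : 0 < p ^ (a - k) := by positivity
  have hposk : 0 < p ^ k := by positivity
  have hposa : 0 < p ^ a := by positivity
  have hdm := Nat.div_add_mod u (p ^ (a - k))
  have hB := Nat.mod_lt u hpos
  have hA : u / p ^ (a - k) < p ^ k := by
    rw [Nat.div_lt_iff_lt_mul hpos, hq]; omega
  have hres : residue p (p ^ a) u k =
      if u = p ^ a - 1 then p ^ a - 1 else p ^ k * u % (p ^ a - 1) := rfl
  generalize u / p ^ (a - k) = A at *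
  generalize u % p ^ (a - k) = B at *
  generalize p ^ (a - k) = Q at *
  generalize p ^ k = K at *
  have hle : K * B + A + 1 ≤ p ^ a := by
    rw [← hq]; nlinarith
  rw [hres]
  split_ifs with h
  · have hAQ : A + 1 = K := by
      by_contra hne
      have : A + 2 ≤ K := by omega
      have h3 : (A + 2) * Q ≤ K * Q := Nat.mul_le_mul_right _ this
      have h4 : (A + 2) * Q = Q * A + 2 * Q := by ring
      omega
    have hBQ : B + 1 = Q := by
      subst hAQ
      have : Q * A + B + 1 = (A + 1) * Q := by omega
      nlinarith
    rw [← hq, ← hAQ, ← hBQ]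
    have : (A + 1) * (B + 1) = (A + 1) * B + A + 1 := by ring
    omega
  -- The rotated number can reach q-1 only if all its digits are p-1, that is, if u = q-1.
  · have hlt : K * B + A < p ^ a - 1 := by
      rcases Nat.lt_or_ge (K * B + A) (p ^ a - 1) with h' | h'
      · exact h'
      exfalso
      apply h
      have e : K * B + A + 1 = K * Q := by omega
      have hBQ : B + 1 = Q := by
        by_contra hne
        have : B + 2 ≤ Q := by omega
        have h3 : K * (B + 2) ≤ K * Q := Nat.mul_le_mul_left _ this
        nlinarith
      have hAK : A + 1 = K := by
        subst hBQ
        have : K * (B + 1) = K * B + K := by ring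
        omega
      rw [← hq, ← hAK, ← hBQ, ← hdm, ← hBQ]
      have : (A + 1) * (B + 1) = (B + 1) * A + B + 1 := by ring
      omega
    have e : K * u = (K * B + A) + (p ^ a - 1) * A := by
      obtain ⟨r, hr⟩ : ∃ r, p ^ a = r + 1 := ⟨p ^ a - 1, by omega⟩
      rw [hr] at hq ⊢
      rw [← hdm, Nat.add_sub_cancel]
      have : K * (Q * A + B) = K * Q * A + K * B := by ring
      rw [this, hq]; ring
    rw [e, Nat.add_mul_mod_self_left, Nat.mod_eq_of_lt hlt]

/-- The digit of `u` which is moved in front in passing from `s_k` to `s_{k+1}`. -/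
def residueCarry (p q u k : ℕ) : ℕ := (p * residue p q u k - residue p q u (k + 1)) / (q - 1)

theorem mul_residue_eq_digit {p a u k : ℕ} (hp : 1 < p) (hk : k < a) (hu : u ≤ p ^ a - 1) :
    p * residue p (p ^ a) u k =
      residue p (p ^ a) u (k + 1) + (p ^ a - 1) * digit p u (a - 1 - k) := by
  have hk' : k + 1 ≤ a := hk
  rw [residue_formula hp hk.le hu, residue_formula hp hk' hu, digit]
  have e1 : a - 1 - k = a - (k + 1) := by omega
  have e2 : p ^ (a - k) = p ^ (a - (k + 1)) * p := by rw [← pow_succ]; congr 1; omega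
  have e3 : p ^ (k + 1) * p ^ (a - (k + 1)) = p ^ a := by rw [← pow_add]; congr 1; omega
  have hposa : 0 < p ^ a := by positivity
  rw [e1, e2, ← Nat.div_div_eq_div_mul, Nat.mod_mul]
  have h := Nat.div_add_mod (u / p ^ (a - (k + 1))) p
  generalize u / p ^ (a - (k + 1)) = V at *
  obtain ⟨r, hr⟩ : ∃ r, p ^ a = r + 1 := ⟨p ^ a - 1, by omega⟩
  rw [hr] at e3 ⊢
  rw [Nat.add_sub_cancel]
  generalize u % p ^ (a - (k + 1)) = B at *
  generalize p ^ (a - (k + 1)) = Q at *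
  generalize V % p = e at *
  generalize V / p = A at *
  have : p * (p ^ k * (B + Q * e) + A) = p ^ (k + 1) * B + (p ^ (k + 1) * Q) * e + p * A := by
    ring
  rw [this, e3, ← h]
  ring

theorem residueCarry_eq_digit {p a u k : ℕ} (hp : 1 < p) (hk : k < a) (hu : u ≤ p ^ a - 1) :
    residueCarry p (p ^ a) u k = digit p u (a - 1 - k) := by
  have hq : p ≤ p ^ a := Nat.le_self_pow (by omega) p
  rw [residueCarry, mul_residue_eq_digit hp hk hu, Nat.add_sub_cancel_left,
    Nat.mul_div_cancel_left _ (by omega)]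

theorem mul_residue {p a u k : ℕ} (hp : 1 < p) (hk : k < a) (hu : u ≤ p ^ a - 1) :
    p * residue p (p ^ a) u k =
      residue p (p ^ a) u (k + 1) + (p ^ a - 1) * residueCarry p (p ^ a) u k := by
  rw [residueCarry_eq_digit hp hk hu, mul_residue_eq_digit hp hk hu]

/-! ### The period of the twist. -/

theorem period_mem {p a u : ℕ} (hp : 1 < p) (ha : 0 < a) :
    a ∈ {m : ℕ | 0 < m ∧ p ^ m * u ≡ u [MOD (p ^ a - 1)]} := by
  refine ⟨ha, ?_⟩
  have h : p ^ a = (p ^ a - 1) + 1 := by have : 0 < p ^ a := by positivity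
                                         omega
  conv_lhs => rw [h, add_mul, one_mul]
  simp [Nat.ModEq]

theorem twistPeriod_spec {p a u : ℕ} (hp : 1 < p) (ha : 0 < a) :
    0 < twistPeriod p (p ^ a) u ∧
      p ^ twistPeriod p (p ^ a) u * u ≡ u [MOD (p ^ a - 1)] :=
  Nat.sInf_mem ⟨a, period_mem hp ha⟩

theorem twistPeriod_le {p a u : ℕ} (hp : 1 < p) (ha : 0 < a) : twistPeriod p (p ^ a) u ≤ a :=
  Nat.sInf_le (period_mem hp ha)

theorem residue_periodic {p a u : ℕ} (hp : 1 < p) (ha : 0 < a) :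
    Function.Periodic (residue p (p ^ a) u) (twistPeriod p (p ^ a) u) := by
  intro k
  unfold residue
  split_ifs
  · rfl
  · rw [pow_add, mul_assoc]
    exact (twistPeriod_spec hp ha).2.mul_left _

theorem residueCarry_periodic {p a u : ℕ} (hp : 1 < p) (ha : 0 < a) :
    Function.Periodic (residueCarry p (p ^ a) u) (twistPeriod p (p ^ a) u) := by
  intro k
  have h := residue_periodic (u := u) hp ha
  rw [residueCarry, h, add_right_comm, h, residueCarry]

theorem sum_range_add_of_periodic {M : Type*} [AddCommMonoid M] {f : ℕ → M} {b : ℕ}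
    (hf : Function.Periodic f b) (m : ℕ) :
    ∑ i ∈ Finset.range b, f (m + i) = ∑ i ∈ Finset.range b, f i := by
  induction m with
  | zero => simp
  | succ m ih =>
    rw [← ih]
    cases b with
    | zero => rfl
    | succ b =>
      rw [Finset.sum_range_succ, Finset.sum_range_succ']
      congr 1
      · exact Finset.sum_congr rfl fun i _ => by congr 1; omega
      · change f (m + 1 + b) = f m
        rw [← hf m]; congr 1; omega

/-- The carries list the digits in reverse order, t_k = u_{a-1-k}. A window of b consecutive carries
starting at a-b, read backwards, is u_0, …, u_{b-1}, and by periodicity the starting point is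
irrelevant. -/
theorem sum_digit_eq_sum_residueCarry {M : Type*} [AddCommMonoid M] {p a u : ℕ} (hp : 1 < p)
    (ha : 0 < a) (hu : u ≤ p ^ a - 1) (F : ℕ → M) :
    ∑ i ∈ Finset.range (twistPeriod p (p ^ a) u), F (digit p u i) =
      ∑ i ∈ Finset.range (twistPeriod p (p ^ a) u), F (residueCarry p (p ^ a) u i) := by
  have hb := twistPeriod_le (u := u) hp ha
  set b := twistPeriod p (p ^ a) u
  have hper : Function.Periodic (fun i => F (residueCarry p (p ^ a) u i)) b := fun i =>
    congrArg F (residueCarry_periodic hp ha i)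
  rw [← sum_range_add_of_periodic hper (a - b), ← Finset.sum_range_reflect]
  refine Finset.sum_congr rfl fun i hi => ?_
  have hi' := Finset.mem_range.mp hi
  rw [residueCarry_eq_digit hp (by omega) hu]
  congr 2
  omega

/-- The residues `s_0, …, s_{b-1}` are distinct modulo `q - 1`. -/
theorem index_eq_of_residue_modEq {p a u i k : ℕ} (hp : 1 < p) (ha : 0 < a)
    (hi : i < twistPeriod p (p ^ a) u) (hk : k < twistPeriod p (p ^ a) u)
    (h : p * residue p (p ^ a) u k ≡ residue p (p ^ a) u i [MOD (p ^ a - 1)]) :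
    i = (k + 1) % twistPeriod p (p ^ a) u := by
  have hcop : Nat.Coprime (p ^ a - 1) p := by
    have h1 : Nat.Coprime (p ^ a - 1) (p ^ a) := by
      have : p ^ a = (p ^ a - 1) + 1 := by
        have : 0 < p ^ a := by positivity
        omega
      rw [this, Nat.add_sub_cancel]
      simp
    exact h1.coprime_dvd_right (dvd_pow_self p ha.ne')
  have hres : ∀ j, residue p (p ^ a) u j ≡ p ^ j * u [MOD (p ^ a - 1)] := by
    intro j
    unfold residue
    split_ifs with hu
    · rw [hu]
      exact (Nat.modEq_zero_iff_dvd.mpr dvd_rfl).trans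
        (Nat.modEq_zero_iff_dvd.mpr (dvd_mul_left _ _)).symm
    · exact Nat.mod_modEq _ _
  have h2 : p ^ (k + 1) * u ≡ p ^ i * u [MOD (p ^ a - 1)] := by
    rw [pow_succ', mul_assoc]
    exact ((hres k).mul_left p).symm.trans (h.trans (hres i))
  -- Since p is invertible modulo q-1, a coincidence between two powers at distance m is already a
  -- period m, and b is the least one.
  have key : ∀ e m, p ^ (e + m) * u ≡ p ^ e * u [MOD (p ^ a - 1)] → 0 < m →
      twistPeriod p (p ^ a) u ≤ m := by
    intro e m hem hm
    refine Nat.sInf_le ⟨hm, ?_⟩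
    rw [pow_add, mul_assoc] at hem
    exact Nat.ModEq.cancel_left_of_coprime (hcop.pow_right e) hem
  rcases lt_trichotomy i (k + 1) with hlt | heq | hgt
  · have := key i (k + 1 - i) (by rwa [Nat.add_sub_cancel' hlt.le]) (by omega)
    have h0 : k + 1 = twistPeriod p (p ^ a) u := by omega
    rw [h0, Nat.mod_self]; omega
  · rw [← heq, Nat.mod_eq_of_lt hi]
  · have := key (k + 1) (i - (k + 1)) (by rw [Nat.add_sub_cancel' hgt.le]; exact h2.symm) (by omega)
    omega

theorem residue_mod_period {p a u k : ℕ} (hp : 1 < p) (ha : 0 < a) :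
    residue p (p ^ a) u (k % twistPeriod p (p ^ a) u) = residue p (p ^ a) u k :=
  (residue_periodic hp ha).map_mod_nat k

/-! ### The arithmetic polygon in terms of the digit slopes -/

theorem period_mul_arithPolygon {p a d u n : ℕ} (hp1 : 1 < p) (ha : 0 < a)
    (hu : u ≤ p ^ a - 1) (hd : 1 < d) (hp : 2 * (d - 1) ^ 2 + 1 < p) :
    (twistPeriod p (p ^ a) u : ℚ) * arithPolygon p (p ^ a) d u n =
      ((∑ i ∈ Finset.range (twistPeriod p (p ^ a) u), ∑ l ∈ Finset.range n,
        digitSlope p d (residueCarry p (p ^ a) u i) l : ℕ) : ℚ) := by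
  rw [← sum_digit_eq_sum_residueCarry hp1 ha hu
    (fun t => ∑ l ∈ Finset.range n, digitSlope p d t l), Finset.sum_comm, arithPolygon,
    Finset.mul_sum, Nat.cast_sum]
  refine Finset.sum_congr rfl fun l _ => ?_
  have hb : (twistPeriod p (p ^ a) u : ℚ) ≠ 0 := by
    have := (twistPeriod_spec (u := u) hp1 ha).1
    positivity
  have hd0 : (d : ℚ) ≠ 0 := by positivity
  rw [Nat.cast_sum, Finset.sum_congr rfl fun i _ => digitSlope_eq (digit p u i) l hd hp,
    Finset.sum_add_distrib, ← Finset.mul_sum, ← Finset.sum_div, Finset.sum_add_distrib,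
    Finset.sum_const, Finset.card_range, nsmul_eq_mul, arithSlope]
  field_simp

/-! ### Coefficients of the Artin-Hasse series and of the splitting series -/

section SplittingSeries

theorem coeff_artinHasseLog_of_lt {p n : ℕ} (hn : n < p) :
    PowerSeries.coeff n (artinHasseLog p) = PowerSeries.coeff n (PowerSeries.X : PowerSeries ℚ) := by
  rw [artinHasseLog, PowerSeries.coeff_mk, PowerSeries.coeff_X]
  by_cases h : n = 1
  · rw [if_pos ⟨0, by simpa using h⟩, if_pos h, h]; norm_num
  · rw [if_neg h, if_neg]
    rintro ⟨i, rfl⟩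
    cases i with
    | zero => exact h (pow_zero p)
    | succ i => exact absurd hn (Nat.le_self_pow (Nat.succ_ne_zero i) p).not_gt

/-- The logarithm is X modulo X^p, so below degree p the series agrees with exp. -/
theorem coeff_artinHasse_of_lt {p n : ℕ} (hp : 1 < p) (hn : n < p) :
    PowerSeries.coeff n (artinHasse p) = 1 / (n.factorial : ℚ) := by
  have hdvd : (PowerSeries.X : PowerSeries ℚ) ^ p ∣ artinHasseLog p - PowerSeries.X := by
    rw [PowerSeries.X_pow_dvd_iff]
    intro m hm
    rw [map_sub, coeff_artinHasseLog_of_lt hm, sub_self]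
  have hsub : PowerSeries.HasSubst (artinHasseLog p) := by
    refine PowerSeries.HasSubst.of_constantCoeff_zero' ?_
    rw [← PowerSeries.coeff_zero_eq_constantCoeff_apply, coeff_artinHasseLog_of_lt (by omega)]
    simp
  have hpow : ∀ m, PowerSeries.coeff n (artinHasseLog p ^ m) = if n = m then 1 else 0 := by
    intro m
    have h := PowerSeries.X_pow_dvd_iff.mp
      (hdvd.trans (sub_dvd_pow_sub_pow (artinHasseLog p) PowerSeries.X m)) n hn
    rw [map_sub, sub_eq_zero] at h
    rw [h, PowerSeries.coeff_X_pow]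
  rw [artinHasse, PowerSeries.coeff_subst' hsub, finsum_eq_single _ n]
  · simp [hpow, PowerSeries.coeff_exp]
  · intro m hm
    rw [hpow, if_neg hm.symm, smul_zero]

variable (p : ℕ) [Fact p.Prime] (k : Type*) [Field k] [CharP k p]

/-- The image in `ℚ_q` of the coefficient `λ_n` of the Artin-Hasse series. -/
def ahCoeff (n : ℕ) : Qq p k :=
  (algebraMap ℚ_[p] (Qq p k)) (Rat.castHom ℚ_[p] (PowerSeries.coeff n (artinHasse p)))

theorem coeff_artinHasseCoef (n : ℕ) :
    PowerSeries.coeff n (artinHasseCoef p k) = PowerSeries.C (ahCoeff p k n) := by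
  rw [artinHasseCoef, PowerSeries.coeff_map]
  rfl

theorem charZero_Qq : CharZero (Qq p k) :=
  charZero_of_injective_algebraMap (algebraMap ℚ_[p] (Qq p k)).injective

theorem ahCoeff_of_lt {n : ℕ} (hn : n < p) : ahCoeff p k n = ((n.factorial : Qq p k))⁻¹ := by
  rw [ahCoeff, coeff_artinHasse_of_lt (Fact.out : p.Prime).one_lt hn]
  simp

theorem teich_ne_zero {lam : k} (h : lam ≠ 0) : teich p k lam ≠ 0 := by
  rw [teich, Ne, IsFractionRing.to_map_eq_zero_iff]
  intro h0
  apply h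
  have := congrArg (fun w => WittVector.coeff w 0) h0
  simpa using this

/-- The leading coefficient of the `m`-th coefficient of the splitting series. -/
def leadCoeff (d : ℕ) (lam : k) (m : ℕ) : Qq p k :=
  ahCoeff p k (m / d) * (ahCoeff p k (m % d) * teich p k lam ^ (m % d))

variable {p k}

/-- γ_m is the sum over di+j = m of λ_i λ_j π^{i+j} times the j-th power of the Teichmüller lift; up
to degree δ(m) in π only the unique minimal pair (m/d, m mod d) can contribute. -/
theorem coeff_coeff_splittingSeries {d q m e : ℕ} (hd : 1 < d) (hq : 1 < q) (lam : k)
    (he : e ≤ d * (q - 1) * minDegree d m) :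
    PowerSeries.coeff e (PowerSeries.coeff m (splittingSeries p k d q lam)) =
      if e = d * (q - 1) * minDegree d m then leadCoeff p k d lam m else 0 := by
  have hD : 0 < d * (q - 1) := Nat.mul_pos (by omega) (by omega)
  have hterm : ∀ x ∈ Finset.HasAntidiagonal.antidiagonal m,
      PowerSeries.coeff e (PowerSeries.coeff x.1
        (PowerSeries.subst (PowerSeries.X ^ d : PowerSeries (Coef p k))
          (PowerSeries.rescale (unif (Qq p k) d q) (artinHasseCoef p k))) *
        PowerSeries.coeff x.2 (PowerSeries.rescale
          (unif (Qq p k) d q * PowerSeries.C (teich p k lam)) (artinHasseCoef p k))) =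
      if d ∣ x.1 ∧ e = d * (q - 1) * (x.1 / d + x.2) then
        ahCoeff p k (x.1 / d) * (ahCoeff p k x.2 * teich p k lam ^ x.2) else 0 := by
    rintro ⟨i, j⟩ _
    rw [PowerSeries.coeff_subst_X_pow (by omega)]
    by_cases h : d ∣ i
    · simp only [h, if_true, true_and, Algebra.algebraMap_self, RingHom.id_apply,
        PowerSeries.coeff_rescale, coeff_artinHasseCoef, unif]
      have : ((PowerSeries.X ^ (d * (q - 1))) ^ (i / d) * PowerSeries.C (ahCoeff p k (i / d)) *
          ((PowerSeries.X ^ (d * (q - 1)) * PowerSeries.C (teich p k lam)) ^ j *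
            PowerSeries.C (ahCoeff p k j)) : PowerSeries (Qq p k)) =
          PowerSeries.C (ahCoeff p k (i / d) * (ahCoeff p k j * teich p k lam ^ j)) *
            PowerSeries.X ^ (d * (q - 1) * (i / d + j)) := by
        simp only [map_mul, map_pow, mul_pow, mul_add, pow_add, pow_mul]
        ring
      rw [this, PowerSeries.coeff_C_mul, PowerSeries.coeff_X_pow]
      simp
    · simp [h]
  rw [splittingSeries, PowerSeries.coeff_mul, map_sum, Finset.sum_congr rfl hterm]
  have hdm := Nat.div_add_mod m d
  have huniq : ∀ x ∈ Finset.HasAntidiagonal.antidiagonal m, d ∣ x.1 → e = d * (q - 1) * (x.1 / d + x.2) →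
      x = (d * (m / d), m % d) ∧ e = d * (q - 1) * minDegree d m := by
    rintro ⟨i, j⟩ hx ⟨c, rfl⟩ h
    have hm : d * c + j = m := by simpa using hx
    simp only [Nat.mul_div_cancel_left c (show 0 < d by omega)] at h
    have h1 : c + j ≤ minDegree d m := by
      rw [h] at he
      exact Nat.le_of_mul_le_mul_left he hD
    have h2 := eq_of_add_le_minDegree (i := c) (j := j) hd (by rw [hm]; exact h1)
    rw [hm] at h2
    refine ⟨by rw [← h2.1, ← h2.2], ?_⟩
    rw [h, minDegree, ← h2.1, ← h2.2]
  rw [Finset.sum_eq_single (d * (m / d), m % d)]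
  · simp only [dvd_mul_right, true_and, Nat.mul_div_cancel_left (m / d) (show 0 < d by omega)]
    rfl
  · intro x hx hne
    rw [if_neg]
    rintro ⟨h1, h2⟩
    exact hne (huniq x hx h1 h2).1
  · intro h
    exact absurd (by simpa using hdm) h

/-- For j ≤ m mod d nothing is borrowed, and m < pd keeps both Artin-Hasse indices below p, where
λ_n = 1/n!. -/
theorem leadCoeff_sub {d m j : ℕ} (lam : k) (hd : 0 < d) (hdp : d ≤ p) (hm : m < p * d)
    (hj : j ≤ m % d) :
    leadCoeff p k d lam (m - j) =
      (((m / d).factorial : Qq p k))⁻¹ * (((m % d - j).factorial : Qq p k))⁻¹ *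
        teich p k lam ^ (m % d - j) := by
  have h := div_mod_sub_of_le hj hd
  have hlt := Nat.mod_lt m hd
  rw [leadCoeff, h.1, h.2, ahCoeff_of_lt, ahCoeff_of_lt, mul_assoc]
  · omega
  · rw [Nat.div_lt_iff_lt_mul hd]; exact hm

end SplittingSeries

/-! ### Principal minors of matrices with weights -/

section Weights

variable {ι R : Type*} [DecidableEq ι] [CommRing R]

/-- Conjugating the weights of rows and columns away. -/
theorem principalMinor_of_weights {G H : Matrix ι ι (PowerSeries R)} {α β ω : ι → ℕ}
    (hω : ∀ I, β I + ω I = α I)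
    (hGH : ∀ I J, G I J * PowerSeries.X ^ β J = PowerSeries.X ^ α I * H I J) (S : Finset ι) :
    principalMinor G S = PowerSeries.X ^ (∑ I ∈ S, ω I) * principalMinor H S := by
  have h1 : (∏ J : S, (PowerSeries.X : PowerSeries R) ^ β J) * principalMinor G S =
      (∏ I : S, (PowerSeries.X : PowerSeries R) ^ α I) * principalMinor H S := by
    rw [principalMinor, principalMinor, ← Matrix.det_mul_row, ← Matrix.det_mul_column]
    congr 1
    ext1 I J
    simp only [Matrix.of_apply, Matrix.submatrix_apply]
    rw [mul_comm, hGH]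
  simp only [Finset.prod_pow_eq_pow_sum, Finset.univ_eq_attach,
    Finset.sum_attach S α, Finset.sum_attach S β] at h1
  have h2 : ∑ I ∈ S, α I = ∑ I ∈ S, β I + ∑ I ∈ S, ω I := by
    rw [← Finset.sum_add_distrib]
    exact Finset.sum_congr rfl fun I _ => (hω I).symm
  rw [h2, pow_add, mul_assoc] at h1
  exact PowerSeries.X_pow_mul_cancel h1

theorem constantCoeff_principalMinor (H : Matrix ι ι (PowerSeries R)) (S : Finset ι) :
    PowerSeries.constantCoeff (principalMinor H S) =
      principalMinor (H.map PowerSeries.constantCoeff) S := by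
  rw [principalMinor, RingHom.map_det]
  rfl

/-- A Fredholm coefficient one of whose principal minors is dominant. -/
theorem fredholmCoeff_of_dominant {G H : Matrix ι ι (PowerSeries R)} {ω : ι → ℕ} {N : ℕ}
    (hG : ∀ S, principalMinor G S = PowerSeries.X ^ (∑ I ∈ S, ω I) * principalMinor H S)
    (hfin : ∀ m, {I | ω I ≤ m}.Finite) {S₀ : Finset ι} (hS₀ : S₀.card = N)
    (hdom : ∀ S : Finset ι, S.card = N → S ≠ S₀ → principalMinor G S ≠ 0 →
      ∑ I ∈ S₀, ω I < ∑ I ∈ S, ω I)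
    (hlead : PowerSeries.constantCoeff (principalMinor H S₀) ≠ 0) :
    MinorsSummable G N ∧ (fredholmCoeff G N).order = ∑ I ∈ S₀, ω I := by
  have hcoeff : ∀ m S, PowerSeries.coeff m (principalMinor G S) ≠ 0 → ∑ I ∈ S, ω I ≤ m := by
    intro m S h
    by_contra! hlt
    apply h
    rw [hG, PowerSeries.coeff_X_pow_mul', if_neg hlt.not_ge]
  refine ⟨fun m => ?_, ?_⟩
  -- A minor contributing in degree m uses only indices of slope at most m.
  · refine ((hfin m).toFinset.powerset.finite_toSet).subset fun S hS => ?_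
    rw [Finset.mem_coe, Finset.mem_powerset]
    intro I hI
    rw [Set.Finite.mem_toFinset]
    exact (Finset.single_le_sum (f := ω) (fun _ _ => Nat.zero_le _) hI).trans (hcoeff m S hS.2)
  · rw [PowerSeries.order_eq_nat]
    constructor
    · rw [fredholmCoeff, PowerSeries.coeff_mk, finsum_eq_single _ ⟨S₀, hS₀⟩]
      · rw [hG, PowerSeries.coeff_X_pow_mul', if_pos le_rfl, Nat.sub_self]
        simpa using hlead
      · rintro ⟨S, hS⟩ hne
        by_contra h
        have hSne : S ≠ S₀ := fun e => hne (Subtype.ext e)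
        have hG0 : principalMinor G S ≠ 0 := fun e => h (by rw [e, map_zero])
        exact absurd (hcoeff _ S h) (hdom S hS hSne hG0).not_ge
    · intro m hm
      rw [fredholmCoeff, PowerSeries.coeff_mk]
      refine finsum_eq_zero_of_forall_eq_zero ?_
      rintro ⟨S, hS⟩
      by_contra h
      have hG0 : principalMinor G S ≠ 0 := fun e => h (by rw [e, map_zero])
      have h1 := hcoeff _ S h
      by_cases e : S = S₀
      · subst e; omega
      · have := hdom S hS e hG0
        omega

end Weights

/-! ### Block cyclic matrices -/

section Cyclic

variable {ι κ R : Type*} [DecidableEq ι] [DecidableEq κ] [CommRing R]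

/-- Some permutation in the determinant expansion has only nonzero entries; it carries the fibre
over `next c` bijectively onto the fibre over `c`. -/
theorem card_fiber_eq_of_principalMinor_ne_zero {G : Matrix ι ι R} {f : ι → κ} {next : κ → κ}
    (hnext : Function.Injective next) (hG : ∀ I J, G I J ≠ 0 → f J = next (f I)) {S : Finset ι}
    (hS : principalMinor G S ≠ 0) (c : κ) :
    (S.filter fun I => f I = next c).card = (S.filter fun I => f I = c).card := by
  rw [principalMinor, Matrix.det_apply] at hS
  obtain ⟨τ, -, hτ⟩ := Finset.exists_ne_zero_of_sum_ne_zero hS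
  have hentry : ∀ i : S, f i = next (f (τ i)) := by
    intro i
    refine hG _ _ fun h0 => hτ ?_
    rw [Finset.prod_eq_zero (Finset.mem_univ i) (by simpa using h0), smul_zero]
  have hcard : ∀ c, (S.filter fun I => f I = c).card =
      ((Finset.univ : Finset S).filter fun i : S => f i = c).card := by
    intro c
    rw [← Finset.card_map (Function.Embedding.subtype _)]
    congr 1
    ext I
    simp [and_comm]
  rw [hcard, hcard]
  refine Finset.card_bij (fun i _ => τ i) ?_ ?_ ?_
  · intro i hi
    rw [Finset.mem_filter] at hi ⊢
    exact ⟨Finset.mem_univ _, hnext ((hentry i).symm.trans hi.2)⟩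
  · intro i _ j _ h
    exact τ.injective h
  · intro i hi
    refine ⟨τ.symm i, ?_, by simp⟩
    rw [Finset.mem_filter] at hi ⊢
    refine ⟨Finset.mem_univ _, ?_⟩
    rw [hentry, Equiv.apply_symm_apply, hi.2]

/-- Exchange argument: the thresholds c have the same total over both sets. After the common part is
cancelled, S₀ lies strictly below them and S at or above them. -/
theorem sum_lt_sum_of_card_fiber_eq [Fintype κ] {S S₀ : Finset ι} {f : ι → κ} {c : κ → ℕ}
    {ω : ι → ℕ}
    (hcard : ∀ x, (S.filter fun I => f I = x).card = (S₀.filter fun I => f I = x).card)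
    (hin : ∀ I ∈ S₀, ω I < c (f I)) (hout : ∀ I ∉ S₀, c (f I) ≤ ω I) (hne : S ≠ S₀) :
    ∑ I ∈ S₀, ω I < ∑ I ∈ S, ω I := by
  have htot : ∀ T : Finset ι, ∑ I ∈ T, c (f I) =
      ∑ x, (T.filter fun I => f I = x).card * c x := by
    intro T
    rw [← Finset.sum_fiberwise T f]
    refine Finset.sum_congr rfl fun x _ => ?_
    rw [Finset.sum_congr rfl (g := fun _ => c x)
      (fun I hI => by rw [(Finset.mem_filter.mp hI).2]), Finset.sum_const, smul_eq_mul]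
  have hcs : ∑ I ∈ S, c (f I) = ∑ I ∈ S₀, c (f I) := by
    rw [htot, htot]
    exact Finset.sum_congr rfl fun x _ => by rw [hcard]
  have hcardS : S.card = S₀.card := by
    rw [Finset.card_eq_sum_card_fiberwise (f := f) (t := Finset.univ) (by simp [Set.MapsTo]),
      Finset.card_eq_sum_card_fiberwise (f := f) (s := S₀) (t := Finset.univ)
        (by simp [Set.MapsTo])]
    exact Finset.sum_congr rfl fun x _ => hcard x
  have hnonempty : (S₀ \ S).Nonempty := by
    rw [Finset.sdiff_nonempty]
    intro hsub
    exact hne (Finset.eq_of_subset_of_card_le hsub hcardS.le).symm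
  have hsplit : ∀ (g : ι → ℕ) (A B : Finset ι),
      ∑ I ∈ A, g I = ∑ I ∈ A \ B, g I + ∑ I ∈ A ∩ B, g I := by
    intro g A B
    rw [← Finset.sdiff_inter_self_left A B, Finset.sum_sdiff Finset.inter_subset_left]
  have h1 := hsplit (fun I => c (f I)) S S₀
  have h2 := hsplit (fun I => c (f I)) S₀ S
  have h3 := hsplit ω S S₀
  have h4 := hsplit ω S₀ S
  rw [Finset.inter_comm] at h2 h4
  have h5 : ∑ I ∈ S₀ \ S, ω I < ∑ I ∈ S₀ \ S, c (f I) :=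
    Finset.sum_lt_sum_of_nonempty hnonempty fun I hI => hin I (Finset.mem_sdiff.mp hI).1
  have h6 : ∑ I ∈ S \ S₀, c (f I) ≤ ∑ I ∈ S \ S₀, ω I :=
    Finset.sum_le_sum fun I hI => hout I (Finset.mem_sdiff.mp hI).2
  omega

end Cyclic

/-- The successor of an index modulo `b`. -/
def cyclicSucc {b : ℕ} (i : Fin b) : Fin b := ⟨(i + 1) % b, Nat.mod_lt _ i.pos⟩

theorem cyclicSucc_injective {b : ℕ} : Function.Injective (cyclicSucc (b := b)) := by
  intro i j h
  have h' : ((i : ℕ) + 1) % b = ((j : ℕ) + 1) % b := congrArg Fin.val h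
  have h2 : (i : ℕ) ≡ j [MOD b] := Nat.ModEq.add_right_cancel' 1 h'
  exact Fin.ext (h2.eq_of_lt_of_lt i.2 j.2)

theorem eq_of_cyclicSucc_invariant {b : ℕ} {α : Type*} {g : Fin b → α}
    (h : ∀ i, g (cyclicSucc i) = g i) (i j : Fin b) : g i = g j := by
  have key : ∀ m (hm : m < b), g ⟨m, hm⟩ = g ⟨0, by omega⟩ := by
    intro m
    induction m with
    | zero => intro _; rfl
    | succ m ih =>
      intro hm
      rw [← ih (by omega), ← h ⟨m, by omega⟩]
      congr 1
      exact Fin.ext (Nat.mod_eq_of_lt hm).symm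
  rw [key i i.2, key j j.2]

/-! ### A determinant of inverse factorials -/

/-- Twisting by powers `c ^ (r_i - j)`, the matrix of the `1 / (r_i - j)!` is nonsingular for
distinct `r_i`. -/
theorem det_inv_factorial_ne_zero {F : Type*} [Field F] [CharZero F] {n : ℕ} {r : Fin n → ℕ}
    (hr : Function.Injective r) {c : F} (hc : c ≠ 0) {e : Fin n → F} (he : ∀ i, e i ≠ 0) :
    (Matrix.of fun i j : Fin n => if (j : ℕ) ≤ r i then
      e i * (((r i - j).factorial : F))⁻¹ * c ^ (r i - j) else 0).det ≠ 0 := by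
  have hfac : ∀ m : ℕ, ((m.factorial : F)) ≠ 0 := fun m => by
    exact_mod_cast m.factorial_ne_zero
  -- 1/(r-j)! is the falling factorial of r of length j divided by r!: a monic polynomial in r of
  -- degree j, vanishing for j > r in accordance with the `else` branch. Row and column factors
  -- apart, this is a Vandermonde determinant.
  have hM : (Matrix.of fun i j : Fin n => if (j : ℕ) ≤ r i then
      e i * (((r i - j).factorial : F))⁻¹ * c ^ (r i - j) else 0) =
      Matrix.of fun i j => (e i * (((r i).factorial : F))⁻¹ * c ^ r i) *
        (Matrix.of fun i j : Fin n => (c ^ (j : ℕ))⁻¹ *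
          (Matrix.of fun i j : Fin n => (descPochhammer F j).eval (r i : F)) i j) i j := by
    ext i j
    simp only [Matrix.of_apply]
    rw [descPochhammer_eval_eq_descFactorial]
    split_ifs with h
    · have h1 := Nat.factorial_mul_descFactorial h
      have h2 : ((r i).factorial : F) = ((r i - j).factorial : F) * ((r i).descFactorial j : F) := by
        exact_mod_cast h1.symm
      have h3 : c ^ r i = c ^ (r i - j) * c ^ (j : ℕ) := by rw [← pow_add, Nat.sub_add_cancel h]
      have h4 : ((r i).descFactorial j : F) ≠ 0 := by
        exact_mod_cast (Nat.descFactorial_eq_zero_iff_lt.not.mpr h.not_gt)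
      rw [h2, h3]
      have := hfac (r i - j)
      field_simp
    · rw [Nat.descFactorial_eq_zero_iff_lt.mpr (not_le.mp h)]
      simp
  rw [hM, Matrix.det_mul_column, Matrix.det_mul_row]
  refine mul_ne_zero ?_ (mul_ne_zero ?_ ?_)
  · exact Finset.prod_ne_zero_iff.mpr fun i _ =>
      mul_ne_zero (mul_ne_zero (he i) (inv_ne_zero (hfac _))) (pow_ne_zero _ hc)
  · exact Finset.prod_ne_zero_iff.mpr fun i _ => inv_ne_zero (pow_ne_zero _ hc)
  · have := Matrix.det_eval_matrixOfPolynomials_eq_det_vandermonde (fun i => (r i : F))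
      (fun j : Fin n => descPochhammer F j) (fun j => descPochhammer_natDegree F j)
      (fun j => monic_descPochhammer F j)
    rw [← this, Matrix.det_vandermonde_ne_zero_iff]
    exact fun i j h => hr (Nat.cast_injective h)

/-! ### `ℚ_p`-linearity of the Frobenius of `ℚ_q` -/

section Frobenius

variable (p : ℕ) [Fact p.Prime] (k : Type*) [Field k] [CharP k p]

/-- Frobenius raises Witt components to the p-th power, and those coming from ℤ_p lie in 𝔽_p. -/
theorem frobenius_padicIntToWitt (y : ℤ_[p]) :
    WittVector.frobenius (padicIntToWitt p k y) = padicIntToWitt p k y := by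
  ext n
  rw [WittVector.coeff_frobenius_charP, padicIntToWitt, RingHom.comp_apply, WittVector.map_coeff,
    ← map_pow, ZMod.pow_card]

theorem algebraMap_algebraMap_Qq (y : ℤ_[p]) :
    algebraMap ℚ_[p] (Qq p k) (algebraMap ℤ_[p] ℚ_[p] y) =
      algebraMap (WittVector p k) (Qq p k) (padicIntToWitt p k y) :=
  IsLocalization.map_eq (M := nonZeroDivisors ℤ_[p]) (S := ℚ_[p])
    (T := nonZeroDivisors (WittVector p k)) (Q := Qq p k)
    (nonZeroDivisors_le_comap_nonZeroDivisors_of_injective _ (padicIntToWitt_injective p k)) y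

variable [PerfectRing k p]

theorem frobenius_algebraMap_Qq (x : ℚ_[p]) :
    WittVector.FractionRing.frobenius p k (algebraMap ℚ_[p] (Qq p k) x) =
      algebraMap ℚ_[p] (Qq p k) x := by
  have key : ∀ y : ℤ_[p], WittVector.FractionRing.frobenius p k
      (algebraMap ℚ_[p] (Qq p k) (algebraMap ℤ_[p] ℚ_[p] y)) =
      algebraMap ℚ_[p] (Qq p k) (algebraMap ℤ_[p] ℚ_[p] y) := by
    intro y
    rw [algebraMap_algebraMap_Qq]
    have h : WittVector.FractionRing.frobenius p k
        (algebraMap (WittVector p k) (Qq p k) (padicIntToWitt p k y)) =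
        algebraMap (WittVector p k) (Qq p k)
          (WittVector.frobeniusEquiv p k (padicIntToWitt p k y)) :=
      IsFractionRing.ringEquivOfRingEquiv_algebraMap _ _
    rw [h, WittVector.frobeniusEquiv_apply, frobenius_padicIntToWitt]
  obtain ⟨y, z, -, rfl⟩ := IsFractionRing.div_surjective (A := ℤ_[p]) x
  rw [map_div₀, map_div₀, key, key]

/-- The inverse Frobenius of `ℚ_q` as a `ℚ_p`-linear map. -/
def frobeniusInvLinear : Qq p k →ₗ[ℚ_[p]] Qq p k where
  toFun := (WittVector.FractionRing.frobenius p k).symm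
  map_add' := map_add _
  map_smul' c x := by
    rw [Algebra.smul_def, Algebra.smul_def, map_mul, RingHom.id_apply]
    congr 1
    rw [RingEquiv.symm_apply_eq, frobenius_algebraMap_Qq]

theorem frobeniusInvLinear_injective : Function.Injective (frobeniusInvLinear p k) :=
  (WittVector.FractionRing.frobenius p k).symm.injective

end Frobenius

/-! ### The entries of the matrix of Dwork's operator -/

section Entries

theorem mul_expo {p a u : ℕ} (hp : 1 < p) (ha : 0 < a) (hu : u ≤ p ^ a - 1) (I : Idx p a u) :
    p * expo p a u I = residue p (p ^ a) u (cyclicSucc I.1 : Fin _) +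
      (p ^ a - 1) * (p * I.2.2 + residueCarry p (p ^ a) u I.1) := by
  have hb := twistPeriod_le (u := u) hp ha
  have h1 : residue p (p ^ a) u (cyclicSucc I.1 : Fin _) = residue p (p ^ a) u (I.1 + 1) :=
    residue_mod_period hp ha
  rw [expo, mul_add, mul_residue hp (I.1.2.trans_le hb) hu, h1]
  ring

/-- Determines which term x^m of E_f carries the column monomial J to the exponent that ψ_p sends to
I: modulo q-1 the block is forced, then m is read off. -/
theorem expo_add_eq_iff {p a u m : ℕ} (hp : 1 < p) (ha : 0 < a) (hu : u ≤ p ^ a - 1)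
    (hq : 1 < p ^ a) (I J : Idx p a u) :
    expo p a u J + (p ^ a - 1) * m = p * expo p a u I ↔
      J.1 = cyclicSucc I.1 ∧ J.2.2 + m = p * I.2.2 + residueCarry p (p ^ a) u I.1 := by
  constructor
  · intro h
    have h1 : J.1 = cyclicSucc I.1 := by
      apply Fin.ext
      refine index_eq_of_residue_modEq hp ha J.1.2 I.1.2 ?_
      have h2 : p * residue p (p ^ a) u I.1 + (p ^ a - 1) * (p * I.2.2) =
          residue p (p ^ a) u J.1 + (p ^ a - 1) * (J.2.2 + m) := by
        rw [expo, expo] at h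
        calc _ = p * (residue p (p ^ a) u I.1 + (p ^ a - 1) * I.2.2) := by ring
          _ = _ := by rw [← h]; ring
      have h3 := congrArg (fun x => x % (p ^ a - 1)) h2
      simpa [Nat.ModEq] using h3
    refine ⟨h1, ?_⟩
    rw [mul_expo hp ha hu, ← h1, expo, add_assoc, Nat.add_left_cancel_iff, ← mul_add] at h
    exact Nat.eq_of_mul_eq_mul_left (by omega) h
  · rintro ⟨h1, h2⟩
    rw [mul_expo hp ha hu, ← h1, ← h2, expo]
    ring

/-- The index `p l + t_k` of the coefficient of the splitting series in a row, column `j = 0`. -/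
def rowDegree (p a u : ℕ) (I : Idx p a u) : ℕ := p * I.2.2 + residueCarry p (p ^ a) u I.1

variable {p : ℕ} [Fact p.Prime] {k : Type*} [Field k] [CharP k p] [PerfectRing k p]

theorem coeff_dworkMatrix {a d u : ℕ} (hp : 1 < p) (ha : 0 < a) (hu : u ≤ p ^ a - 1)
    (hq : 1 < p ^ a) (lam : k) (ξ : Module.Basis (Fin a) ℚ_[p] (Qq p k)) (I J : Idx p a u)
    (e : ℕ) :
    PowerSeries.coeff e (dworkMatrix p k a d u lam ξ I J) =
      if J.1 = cyclicSucc I.1 ∧ J.2.2 ≤ rowDegree p a u I then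
        ξ.coord I.2.1 (frobeniusInvLinear p k (PowerSeries.coeff e
          (PowerSeries.coeff (rowDegree p a u I - J.2.2) (splittingSeries p k d (p ^ a) lam)) *
            ξ J.2.1))
      else 0 := by
  have h0 : PowerSeries.coeff e (dworkMatrix p k a d u lam ξ I J) =
      ξ.coord I.2.1 (frobeniusInvLinear p k (PowerSeries.coeff e
        (PowerSeries.coeff (p * expo p a u I) (splittingSeriesRoot p k d (p ^ a) lam *
          basisElt p k a u ξ J)))) := by
    simp [dworkMatrix, coordSeries, dworkOp, sigmaInv, psi, frobeniusInvLinear]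
  have hexp := fun m => expo_add_eq_iff (m := m) hp ha hu hq I J
  have hmon : basisElt p k a u ξ J = PowerSeries.C (PowerSeries.C (ξ J.2.1)) *
      PowerSeries.X ^ expo p a u J := by
    ext1 m
    rw [basisElt, PowerSeries.coeff_monomial, PowerSeries.coeff_C_mul, PowerSeries.coeff_X_pow,
      mul_ite, mul_one, mul_zero]
  rw [h0, hmon, ← mul_assoc, PowerSeries.coeff_mul_X_pow']
  split_ifs with h1 h2 h2
  · obtain ⟨m, hm⟩ := Nat.exists_eq_add_of_le h2.2
    have h3 := (hexp m).mpr ⟨h2.1, hm.symm⟩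
    rw [PowerSeries.coeff_mul_C, splittingSeriesRoot, PowerSeries.coeff_subst_X_pow (by omega),
      ← h3, Nat.add_sub_cancel_left, if_pos (dvd_mul_right _ _),
      Nat.mul_div_cancel_left _ (by omega), hm, Nat.add_sub_cancel_left]
    rw [Algebra.algebraMap_self, RingHom.id_apply, PowerSeries.coeff_mul_C]
  · rw [PowerSeries.coeff_mul_C, splittingSeriesRoot, PowerSeries.coeff_subst_X_pow (by omega),
      if_neg]
    · simp
    · rintro ⟨m, hm⟩
      have h3 := (hexp m).mp (by omega)
      exact h2 ⟨h3.1, by unfold rowDegree; omega⟩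
  · exfalso
    obtain ⟨m, hm⟩ := Nat.exists_eq_add_of_le h2.2
    have h3 := (hexp m).mpr ⟨h2.1, hm.symm⟩
    omega
  · simp

end Entries

/-! ### Weights and the dominant minor -/

section ReducedMatrix

/-- The weight `d (q - 1) δ(p l + t_k)` of a row. -/
def rowWeight (p a d u : ℕ) (I : Idx p a u) : ℕ :=
  d * (p ^ a - 1) * minDegree d (rowDegree p a u I)

/-- The weight `d (q - 1) δ(j)` of a column. -/
def colWeight (p a d u : ℕ) (J : Idx p a u) : ℕ := d * (p ^ a - 1) * minDegree d J.2.2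

/-- The `ϖ`-adic slope of a basis element. -/
def idxSlope (p a d u : ℕ) (I : Idx p a u) : ℕ :=
  d * (p ^ a - 1) * digitSlope p d (residueCarry p (p ^ a) u I.1) I.2.2

/-- The matrix of Dwork's operator stripped of its weights. -/
def reducedMatrix (p : ℕ) [Fact p.Prime] (k : Type*) [Field k] [CharP k p] [PerfectRing k p]
    (a d u : ℕ) (lam : k) (ξ : Module.Basis (Fin a) ℚ_[p] (Qq p k)) :
    Matrix (Idx p a u) (Idx p a u) (PowerSeries ℚ_[p]) :=
  Matrix.of fun I J => PowerSeries.mk fun m => PowerSeries.coeff (m + rowWeight p a d u I)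
    (dworkMatrix p k a d u lam ξ I J * PowerSeries.X ^ colWeight p a d u J)

theorem colWeight_add_idxSlope {p a d u : ℕ} (hd : 1 < d) (hp : 2 * (d - 1) ^ 2 + 1 < p) (I : Idx p a u) :
    colWeight p a d u I + idxSlope p a d u I = rowWeight p a d u I := by
  rw [colWeight, idxSlope, rowWeight, rowDegree, ← mul_add, minDegree_add_digitSlope _ _ hd hp]

/-- The indices `(i, v, j)` with `j < n`. -/
def dominantSet (p a u n : ℕ) : Finset (Idx p a u) :=
  Finset.univ ×ˢ (Finset.univ ×ˢ Finset.range n)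

theorem mem_dominantSet {p a u n : ℕ} {I : Idx p a u} : I ∈ dominantSet p a u n ↔ I.2.2 < n := by
  simp [dominantSet]

theorem card_fiber_dominantSet (p a u n : ℕ) (x : Fin (twistPeriod p (p ^ a) u)) :
    ((dominantSet p a u n).filter fun I => I.1 = x).card = a * n := by
  have : ((dominantSet p a u n).filter fun I => I.1 = x) =
      {x} ×ˢ ((Finset.univ : Finset (Fin a)) ×ˢ Finset.range n) := by
    ext ⟨i, v, l⟩
    simp [dominantSet, and_comm, eq_comm]
  rw [this]
  simp

theorem card_dominantSet (p a u n : ℕ) :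
    (dominantSet p a u n).card = a * twistPeriod p (p ^ a) u * n := by
  simp [dominantSet]
  ring

theorem sum_idxSlope_dominantSet (p a d u n : ℕ) :
    ∑ I ∈ dominantSet p a u n, idxSlope p a d u I =
      d * (p ^ a - 1) * (a * ∑ i ∈ Finset.range (twistPeriod p (p ^ a) u), ∑ l ∈ Finset.range n,
        digitSlope p d (residueCarry p (p ^ a) u i) l) := by
  rw [dominantSet, Finset.sum_product, Finset.sum_range, Finset.mul_sum, Finset.mul_sum]
  refine Finset.sum_congr rfl fun i _ => ?_
  simp only [Finset.sum_product, idxSlope, ← Finset.mul_sum, Finset.sum_const, Finset.card_univ,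
    Fintype.card_fin, smul_eq_mul]

theorem residueCarry_lt {p a u : ℕ} (hp : 1 < p) (ha : 0 < a) (hu : u ≤ p ^ a - 1)
    (i : Fin (twistPeriod p (p ^ a) u)) : residueCarry p (p ^ a) u i < p := by
  rw [residueCarry_eq_digit hp (i.2.trans_le (twistPeriod_le hp ha)) hu]
  exact Nat.mod_lt _ (by omega)

theorem eq_zero_of_leading_system {p : ℕ} [Fact p.Prime] {k : Type*} [Field k] [CharP k p]
    {d n t : ℕ} {lam : k} (hlam : lam ≠ 0) (hn : n ≤ d - 1)
    (hd : 1 < d) (hdp : d < p) (ht : t < p) {z : ℕ → Qq p k}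
    (hz : ∀ l < n, ∑ j ∈ Finset.range n, (if j ≤ (p * l + t) % d then
      leadCoeff p k d lam (p * l + t - j) else 0) * z j = 0) :
    ∀ j < n, z j = 0 := by
  have := charZero_Qq p k
  have hbound : ∀ i : Fin n, p * i + t < p * d := by
    intro i
    have h1 : p * (i + 1) ≤ p * (d - 1) := Nat.mul_le_mul_left _ (by omega)
    have h2 : p * (d - 1) ≤ p * d := Nat.mul_le_mul_left _ (by omega)
    rw [mul_add] at h1
    omega
  -- p is invertible modulo d because d < p, and n < d.
  have hinj : Function.Injective fun i : Fin n => (p * (i : ℕ) + t) % d := by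
    intro i j h
    have h1 : p * (i : ℕ) ≡ p * j [MOD d] := Nat.ModEq.add_right_cancel' t h
    have hcop : Nat.Coprime d p :=
      (Nat.coprime_of_lt_prime (by omega) hdp (Fact.out : p.Prime)).symm
    have h2 := Nat.ModEq.cancel_left_of_coprime hcop h1
    exact Fin.ext (h2.eq_of_lt_of_lt (by omega) (by omega))
  have hdet := det_inv_factorial_ne_zero hinj (teich_ne_zero p k hlam)
    (e := fun i : Fin n => ((((p * (i : ℕ) + t) / d).factorial : Qq p k))⁻¹)
    (fun i => inv_ne_zero (by exact_mod_cast Nat.factorial_ne_zero _))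
  have hzero := Matrix.eq_zero_of_mulVec_eq_zero (v := fun j : Fin n => z j) hdet (by
    ext i
    rw [Matrix.mulVec, dotProduct, Pi.zero_apply]
    refine Eq.trans ?_ (hz i i.2)
    rw [Finset.sum_range]
    refine Finset.sum_congr rfl fun j _ => ?_
    rw [Matrix.of_apply]
    congr 1
    split_ifs with h
    · rw [leadCoeff_sub lam (by omega) hdp.le (hbound i) h]
    · rfl)
  intro j hj
  exact congrFun hzero ⟨j, hj⟩

variable {p : ℕ} [Fact p.Prime] {k : Type*} [Field k] [CharP k p] [PerfectRing k p] {a d u : ℕ}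

/-- Subadditivity of δ: the coefficients discarded by the shift in `reducedMatrix` are zero. -/
theorem dworkMatrix_mul_eq (hd : 1 < d) (hp : 1 < p) (ha : 0 < a) (hu : u ≤ p ^ a - 1)
    (hq : 1 < p ^ a) (lam : k) (ξ : Module.Basis (Fin a) ℚ_[p] (Qq p k)) (I J : Idx p a u) :
    dworkMatrix p k a d u lam ξ I J * PowerSeries.X ^ colWeight p a d u J =
      PowerSeries.X ^ rowWeight p a d u I * reducedMatrix p k a d u lam ξ I J := by
  ext m
  rw [PowerSeries.coeff_X_pow_mul', reducedMatrix]
  split_ifs with h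
  · rw [Matrix.of_apply, PowerSeries.coeff_mk, Nat.sub_add_cancel h]
  · rw [PowerSeries.coeff_mul_X_pow']
    split_ifs with h1
    · rw [coeff_dworkMatrix hp ha hu hq]
      split_ifs with h2
      · have h3 : rowWeight p a d u I ≤ d * (p ^ a - 1) *
            minDegree d (rowDegree p a u I - J.2.2) + colWeight p a d u J := by
          rw [rowWeight, colWeight, ← mul_add]
          have := minDegree_add_le d (rowDegree p a u I - J.2.2) J.2.2 (by omega)
          rw [Nat.sub_add_cancel h2.2] at this
          exact Nat.mul_le_mul_left _ this
        rw [coeff_coeff_splittingSeries hd hq lam (by omega), if_neg (by omega), zero_mul,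
          map_zero, map_zero]
      · rfl
    · rfl

/-- A constant term survives only where δ(M) = δ(M-j) + δ(j). For j < d this means that subtracting
j from M borrows nothing, i.e. j ≤ M mod d. -/
theorem constantCoeff_reducedMatrix (hd : 1 < d) (hp : 1 < p) (ha : 0 < a) (hu : u ≤ p ^ a - 1)
    (hq : 1 < p ^ a) (lam : k) (ξ : Module.Basis (Fin a) ℚ_[p] (Qq p k)) (I J : Idx p a u)
    (hJ : J.2.2 < d) :
    PowerSeries.constantCoeff (reducedMatrix p k a d u lam ξ I J) =
      if J.1 = cyclicSucc I.1 ∧ J.2.2 ≤ rowDegree p a u I % d then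
        ξ.coord I.2.1 (frobeniusInvLinear p k
          (leadCoeff p k d lam (rowDegree p a u I - J.2.2) * ξ J.2.1))
      else 0 := by
  have hD : 0 < d * (p ^ a - 1) := Nat.mul_pos (by omega) (by omega)
  have hmod : rowDegree p a u I % d ≤ rowDegree p a u I := Nat.mod_le _ _
  rw [← PowerSeries.coeff_zero_eq_constantCoeff_apply, reducedMatrix, Matrix.of_apply,
    PowerSeries.coeff_mk, zero_add, PowerSeries.coeff_mul_X_pow', coeff_dworkMatrix hp ha hu hq]
  have hrow : rowWeight p a d u I = d * (p ^ a - 1) * minDegree d (rowDegree p a u I) := rfl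
  generalize rowDegree p a u I = M at *
  have hcol : colWeight p a d u J = d * (p ^ a - 1) * J.2.2 := by
    rw [colWeight, minDegree_of_lt hJ]
  rw [hrow, hcol]
  by_cases h1 : J.1 = cyclicSucc I.1
  swap
  · simp [h1]
  by_cases h2 : J.2.2 ≤ M % d
  · have h3 := div_mod_sub_of_le h2 (by omega)
    have h4 : minDegree d (M - J.2.2) = minDegree d M - J.2.2 := by
      rw [minDegree, minDegree, h3.1, h3.2, Nat.add_sub_assoc h2]
    have h5 : J.2.2 ≤ minDegree d M := h2.trans (Nat.le_add_left _ _)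
    rw [if_pos (Nat.mul_le_mul_left _ h5), if_pos ⟨h1, h2.trans hmod⟩, if_pos ⟨h1, h2⟩,
      ← Nat.mul_sub, ← h4, coeff_coeff_splittingSeries hd hq lam le_rfl, if_pos rfl]
  · rw [if_neg (c := J.1 = cyclicSucc I.1 ∧ J.2.2 ≤ M % d) (by tauto)]
    split_ifs with h3 h4
    · have h5 := minDegree_lt_of_lt (not_le.mp h2) hd h4.2
      have h6 : minDegree d M - J.2.2 < minDegree d (M - J.2.2) := by
        have := Nat.le_of_mul_le_mul_left h3 hD
        omega
      have h7 := Nat.mul_lt_mul_of_pos_left h6 hD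
      rw [← Nat.mul_sub, coeff_coeff_splittingSeries hd hq lam h7.le, if_neg h7.ne, zero_mul,
        map_zero, map_zero]
    · rfl
    · rfl

theorem principalMinor_reducedMatrix_ne_zero {n : ℕ} {lam : k} (hlam : lam ≠ 0)
    (hn : n ≤ d - 1) (hd : 1 < d) (hdp : d < p) (ha : 0 < a) (hu : u ≤ p ^ a - 1)
    (ξ : Module.Basis (Fin a) ℚ_[p] (Qq p k)) :
    PowerSeries.constantCoeff
      (principalMinor (reducedMatrix p k a d u lam ξ) (dominantSet p a u n)) ≠ 0 := by
  have hp1 : 1 < p := (Fact.out : p.Prime).one_lt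
  have hq : 1 < p ^ a := Nat.one_lt_pow ha.ne' hp1
  rw [constantCoeff_principalMinor, principalMinor]
  generalize hS : dominantSet p a u n = S
  intro hdet
  obtain ⟨v, hv, hMv⟩ := Matrix.exists_mulVec_eq_zero_iff.mpr hdet
  apply hv
  let x : Idx p a u → ℚ_[p] := fun J => if h : J ∈ S then v ⟨J, h⟩ else 0
  -- Reassembles the ℚ_p-coordinates of the kernel vector into elements of ℚ_q, so that the rows
  -- with the same (i, l) form one equation over ℚ_q under σ⁻¹.
  let z : Fin (twistPeriod p (p ^ a) u) → ℕ → Qq p k := fun i j => ∑ w, x (i, w, j) • ξ w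
  have hsum : ∀ I ∈ S, ∑ J ∈ S,
      PowerSeries.constantCoeff (reducedMatrix p k a d u lam ξ I J) * x J = 0 := by
    intro I hI
    have h := congrFun hMv ⟨I, hI⟩
    rw [Matrix.mulVec, dotProduct, Pi.zero_apply] at h
    rw [← h, ← Finset.sum_coe_sort]
    refine Finset.sum_congr rfl fun J _ => ?_
    simp [x]
  have hrow : ∀ (i : Fin (twistPeriod p (p ^ a) u)) w, ∀ l < n, ξ.coord w (frobeniusInvLinear p k (∑ j ∈ Finset.range n,
      (if j ≤ (p * l + residueCarry p (p ^ a) u i) % d then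
        leadCoeff p k d lam (p * l + residueCarry p (p ^ a) u i - j) else 0) *
          z (cyclicSucc i) j)) = 0 := by
    intro i w l hl
    refine Eq.trans ?_ (hsum (i, w, l) (hS ▸ mem_dominantSet.mpr hl))
    rw [← hS, dominantSet, Finset.sum_product, Finset.sum_eq_single (cyclicSucc i)]
    · rw [Finset.sum_product_right, map_sum, map_sum]
      refine Finset.sum_congr rfl fun j hj => ?_
      simp only [z]
      rw [Finset.mul_sum, map_sum, map_sum]
      refine Finset.sum_congr rfl fun w' _ => ?_
      have hjn := Finset.mem_range.mp hj
      rw [constantCoeff_reducedMatrix hd hp1 ha hu hq _ _ _ _ (show j < d by omega)]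
      simp only [true_and, rowDegree]
      rw [mul_smul_comm, map_smul, map_smul, smul_eq_mul, mul_comm]
      split_ifs
      · rfl
      · rw [zero_mul, map_zero, map_zero]
    · rintro i' - hne
      refine Finset.sum_eq_zero fun y hy => ?_
      have hyn := Finset.mem_range.mp (Finset.mem_product.mp hy).2
      rw [constantCoeff_reducedMatrix hd hp1 ha hu hq _ _ _ _ (show y.2 < d by omega),
        if_neg (fun h => hne h.1), zero_mul]
    · intro h
      exact absurd (Finset.mem_univ _) h
  have hz : ∀ i, ∀ j < n, z i j = 0 := by
    intro i
    -- The rows of block i constrain the unknowns of block i+1, so each block is written as a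
    -- successor.
    obtain ⟨i, rfl⟩ := Finite.surjective_of_injective cyclicSucc_injective i
    refine eq_zero_of_leading_system hlam hn hd hdp (residueCarry_lt hp1 ha hu i) fun l hl => ?_
    refine frobeniusInvLinear_injective p k ?_
    rw [map_zero]
    refine ξ.ext_elem fun w => ?_
    rw [map_zero, Finsupp.zero_apply]
    exact hrow i w l hl
  ext ⟨⟨i, w, j⟩, hJ⟩
  have h1 := Fintype.linearIndependent_iff.mp ξ.linearIndependent (fun w => x (i, w, j))
    (hz i j (mem_dominantSet.mp (hS ▸ hJ))) w
  simpa [x, hJ] using h1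

end ReducedMatrix

end TwistedDwork

end

/-! ### The order of the Fredholm coefficient. -/

theorem theorem4p5 (p : ℕ) [Fact p.Prime] (k : Type*) [Field k] [Fintype k] [CharP k p]
    (a : ℕ) (hq : Fintype.card k = p ^ a) (d u n : ℕ) (lam : k) (hlam : lam ≠ 0)
    (hu : u ≤ p ^ a - 1) (hn : 1 ≤ n) (hnd : n ≤ d - 1) (hp : 2 * (d - 1) ^ 2 + 1 < p)
    (ξ : Module.Basis (Fin a) ℚ_[p] (TwistedDwork.Qq p k)) :
    TwistedDwork.MinorsSummable (TwistedDwork.dworkMatrix p k a d u lam ξ)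
        (a * TwistedDwork.twistPeriod p (p ^ a) u * n) ∧
      TwistedDwork.ordPi d (p ^ a)
          (TwistedDwork.fredholmCoeff (TwistedDwork.dworkMatrix p k a d u lam ξ)
            (a * TwistedDwork.twistPeriod p (p ^ a) u * n)) =
        (((a : ℚ) * (TwistedDwork.twistPeriod p (p ^ a) u : ℚ) *
          TwistedDwork.arithPolygon p (p ^ a) d u n : ℚ) : WithTop ℚ) := by
  open TwistedDwork in
  have hp1 : 1 < p := (Fact.out : p.Prime).one_lt
  have hcard : 1 < p ^ a := hq ▸ Fintype.one_lt_card
  have ha : 0 < a := by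
    rcases Nat.eq_zero_or_pos a with rfl | h
    · simp at hcard
    · exact h
  have hd : 1 < d := by omega
  have hdp : d < p := by
    have : d - 1 ≤ (d - 1) ^ 2 := Nat.le_self_pow (by norm_num) _
    omega
  have hD : 0 < d * (p ^ a - 1) := Nat.mul_pos (by omega) (by omega)
  have hdom : ∀ S : Finset (Idx p a u), S.card = a * twistPeriod p (p ^ a) u * n →
      S ≠ dominantSet p a u n → principalMinor (dworkMatrix p k a d u lam ξ) S ≠ 0 →
      ∑ I ∈ dominantSet p a u n, idxSlope p a d u I < ∑ I ∈ S, idxSlope p a d u I := by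
    intro S hS hne hminor
    have hfib := card_fiber_eq_of_principalMinor_ne_zero (f := fun I : Idx p a u => I.1)
      cyclicSucc_injective (fun I J h => by
        by_contra hIJ
        refine h (PowerSeries.ext fun e => ?_)
        rw [coeff_dworkMatrix hp1 ha hu hcard, if_neg (fun h' => hIJ h'.1), map_zero]) hminor
    have hconst := eq_of_cyclicSucc_invariant
      (g := fun c => (S.filter fun I : Idx p a u => I.1 = c).card) hfib
    have hcardfib : ∀ x, (S.filter fun I => I.1 = x).card = a * n := by
      intro x
      have h1 := Finset.card_eq_sum_card_fiberwise (s := S) (f := fun I : Idx p a u => I.1)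
        (t := Finset.univ) (by simp [Set.MapsTo])
      rw [hS, Finset.sum_congr rfl fun y _ => hconst y x, Finset.sum_const, Finset.card_univ,
        Fintype.card_fin, smul_eq_mul] at h1
      have hb := (twistPeriod_spec (u := u) hp1 ha).1
      refine (Nat.eq_of_mul_eq_mul_left hb ?_).symm
      rw [← h1]; ring
    -- The threshold of a block is its slope at l = n, which separates l < n from l ≥ n.
    refine sum_lt_sum_of_card_fiber_eq (f := fun I : Idx p a u => I.1)
      (c := fun i => d * (p ^ a - 1) * digitSlope p d (residueCarry p (p ^ a) u i) n)
      (fun x => by rw [hcardfib, card_fiber_dominantSet]) ?_ ?_ hne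
    · intro I hI
      exact Nat.mul_lt_mul_of_pos_left
        (digitSlope_strictMono _ hd hp (mem_dominantSet.mp hI)) hD
    · intro I hI
      rw [mem_dominantSet, not_lt] at hI
      exact Nat.mul_le_mul_left _ ((digitSlope_strictMono _ hd hp).monotone hI)
  have hfin : ∀ m, {I : Idx p a u | idxSlope p a d u I ≤ m}.Finite := by
    intro m
    refine (dominantSet p a u (m + 1)).finite_toSet.subset fun I hI => ?_
    rw [Finset.mem_coe, mem_dominantSet, Nat.lt_succ_iff]
    -- A strictly increasing sequence of naturals satisfies l ≤ ω(l), so a bounded slope bounds l.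
    refine ((digitSlope_strictMono (residueCarry p (p ^ a) u I.1) hd hp).le_apply).trans (le_trans ?_ hI)
    exact Nat.le_mul_of_pos_left _ hD
  have hmain := fredholmCoeff_of_dominant
    (principalMinor_of_weights (colWeight_add_idxSlope hd hp)
      (dworkMatrix_mul_eq hd hp1 ha hu hcard lam ξ))
    hfin (card_dominantSet p a u n) hdom
    (principalMinor_reducedMatrix_ne_zero hlam hnd hd hdp ha hu ξ)
  refine ⟨hmain.1, ?_⟩
  rw [ordPi, hmain.2, sum_idxSlope_dominantSet, mul_assoc (a : ℚ),
    period_mul_arithPolygon hp1 ha hu hd hp]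
  refine (WithTop.map_coe _ _).trans (congrArg _ ?_)
  have hd0 : (d : ℚ) ≠ 0 := by positivity
  have hq0 : (p : ℚ) ^ a - 1 ≠ 0 := by
    have : (1 : ℚ) < (p : ℚ) ^ a := by exact_mod_cast hcard
    linarith
  rw [Nat.cast_mul, Nat.cast_mul, Nat.cast_sub hcard.le, Nat.cast_mul]
  push_cast
  field_simp
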